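/- A bipartite graph $G=(A,B,E)$ is given with its bipartition. Three operations are considered: adding an edge between a vertex of $A$ and a vertex of $B$; deleting an edge; and splitting a vertex $v$, that is, replacing $v$ by two copies $v_1,v_2$ on the same side with $N(v_1)\cup N(v_2)=N(v)$ (the two neighborhoods may overlap). In Bicluster Editing with Vertex Splitting (BCEVS), one is given $G$ and a number $k$ and asks whether at most $k$ operations can turn $G$ into a disjoint union of bicliques, i.e. a bipartite graph in which any two vertices of the same connected component on different sides are adjacent. Bicluster Editing with One-Sided Vertex Splitting (BCEOVS) is the same problem where only vertices of the side $B$ may be split. **Theorem.** Restricted to trees, BCEVS and BCEOVS are solvable in time $O(n^2)$, where $n$ is the number of vertices. That is, for each of the two problems there are a random access machine program and a constant $C$ such that, for every tree $T=(A,B,E)$ on the vertices $0,\dots,n-1$ (given by the side of each vertex and a list of the edges in arbitrary order and orientation) and every $k\ge 0$, the program halts after at most $Cn^2$ steps with the correct answer to the instance $(T,k)$. Likewise, for each of the two problems there is a program that computes from $T$, in at most $Cn^2$ steps for a constant $C$, the minimum number of operations needed. Here each instruction (setting a register to a constant, copying a register, successor, predecessor, indirect load, indirect store) and each comparison of two registers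 counts as one step. -/

import Mathlib

/-- The two sides of a bipartite graph. -/
inductive Side where
  | A
  | B

/-- A bipartite graph `G = (A, B, E)` on the vertex type `V`: a simple graph together with the
side of each vertex, every edge joining the two sides. -/
structure BipGraph (V : Type) where
  graph : SimpleGraph V
  side : V → Side
  side_ne : ∀ u v, graph.Adj u v → side u ≠ side v

namespace BipGraph

/-- `H` arises from `G` by adding one new edge between a vertex of `A` and a vertex of `B`. -/
def IsEdgeAddition {V : Type} (G H : BipGraph V) : Prop :=
  H.side = G.side ∧ ∃ a b, ¬ G.graph.Adj a b ∧ G.side a ≠ G.side b ∧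
    ∀ u v, H.graph.Adj u v ↔ (G.graph.Adj u v ∨ s(u, v) = s(a, b))

/-- `H` arises from `G` by deleting one edge. -/
def IsEdgeDeletion {V : Type} (G H : BipGraph V) : Prop :=
  H.side = G.side ∧ ∃ a b, G.graph.Adj a b ∧
    ∀ u v, H.graph.Adj u v ↔ (G.graph.Adj u v ∧ s(u, v) ≠ s(a, b))

/-- `H` arises from `G` by splitting the vertex `v` into the two copies `some v` and `none`, which
lie on the side of `v` and whose neighborhoods have union `N(v)` (they may overlap, and either may
be empty). Every other vertex `u` is kept as `some u`. The copies are not adjacent to each other,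
because they lie on the same side. -/
def IsSplitAt {V : Type} (G : BipGraph V) (v : V) (H : BipGraph (Option V)) : Prop :=
  (∀ u, H.side (some u) = G.side u) ∧ H.side none = G.side v ∧
  (∀ u w, u ≠ v → w ≠ v → (H.graph.Adj (some u) (some w) ↔ G.graph.Adj u w)) ∧
  (∀ w, w ≠ v →
    (G.graph.Adj v w ↔ (H.graph.Adj (some v) (some w) ∨ H.graph.Adj none (some w))))

/-- `EditSeq S G H m`: the graph `H` arises from `G` by a sequence of exactly `m` edge additions,
edge deletions and vertex splittings, where only vertices on a side in `S` are split. -/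
inductive EditSeq (S : Set Side) :
    {V W : Type} → BipGraph V → BipGraph W → ℕ → Prop where
  | nil {V : Type} (G : BipGraph V) : EditSeq S G G 0
  | add {V W : Type} {G G' : BipGraph V} {H : BipGraph W} {m : ℕ} :
      IsEdgeAddition G G' → EditSeq S G' H m → EditSeq S G H (m + 1)
  | del {V W : Type} {G G' : BipGraph V} {H : BipGraph W} {m : ℕ} :
      IsEdgeDeletion G G' → EditSeq S G' H m → EditSeq S G H (m + 1)
  | split {V W : Type} {G : BipGraph V} {G' : BipGraph (Option V)} {H : BipGraph W} {m : ℕ}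
      (v : V) : G.side v ∈ S → IsSplitAt G v G' → EditSeq S G' H m → EditSeq S G H (m + 1)

/-- `G` is a disjoint union of bicliques: in every connected component all pairs of vertices
from different sides are adjacent. (An isolated vertex is a biclique with one empty side.) -/
def IsBiclusterGraph {V : Type} (G : BipGraph V) : Prop :=
  ∀ u v, G.graph.Reachable u v → G.side u ≠ G.side v → G.graph.Adj u v

/-- `m` operations, with splittings only on the sides in `S`, can turn `G` into a disjoint union
of bicliques. -/
def CanBecomeBicluster (S : Set Side) {V : Type} (G : BipGraph V) (m : ℕ) : Prop :=
  ∃ (W : Type) (H : BipGraph W), EditSeq S G H m ∧ H.IsBiclusterGraph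

end BipGraph

/-- Bicluster Editing with Vertex Splitting: `(G, k)` is a yes-instance. -/
def BCEVS {V : Type} (G : BipGraph V) (k : ℕ) : Prop :=
  ∃ m ≤ k, G.CanBecomeBicluster Set.univ m

/-- Bicluster Editing with One-Sided Vertex Splitting: `(G, k)` is a yes-instance; only vertices
of the side `B` may be split. -/
def BCEOVS {V : Type} (G : BipGraph V) (k : ℕ) : Prop :=
  ∃ m ≤ k, G.CanBecomeBicluster {Side.B} m

namespace RAM

/-- Memory of a random access machine: registers and arrays, all holding natural numbers.
A program mentions only finitely many registers and arrays. -/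
structure State where
  reg : ℕ → ℕ
  arr : ℕ → ℕ → ℕ

def State.setReg (s : State) (r x : ℕ) : State :=
  { s with reg := Function.update s.reg r x }

def State.setArr (s : State) (a i x : ℕ) : State :=
  { s with arr := Function.update s.arr a (Function.update (s.arr a) i x) }

/-- Unit-cost instructions. The only arithmetic is successor and predecessor, so a run of `t` steps
uses only numbers bounded by the input numbers, the constants of the program and `t`:
no large numbers can be manipulated at unit cost. -/
inductive Instr where
  /-- `reg r := c` -/
  | const (r c : ℕ)
  /-- `reg r := reg q` -/
  | move (r q : ℕ)
  /-- `reg r := reg r + 1` -/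
  | succ (r : ℕ)
  /-- `reg r := reg r - 1`, with `0 - 1 = 0` -/
  | pred (r : ℕ)
  /-- `reg r := arr a [reg i]` -/
  | load (r a i : ℕ)
  /-- `arr a [reg i] := reg r` -/
  | store (a i r : ℕ)

def Instr.apply : Instr → State → State
  | .const r c, s => s.setReg r c
  | .move r q, s => s.setReg r (s.reg q)
  | .succ r, s => s.setReg r (s.reg r + 1)
  | .pred r, s => s.setReg r (s.reg r - 1)
  | .load r a i, s => s.setReg r (s.arr a (s.reg i))
  | .store a i r, s => s.setArr a (s.reg i) (s.reg r)

/-- Tests comparing two registers. -/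
inductive Test where
  | eq (r q : ℕ)
  | lt (r q : ℕ)

def Test.Holds : Test → State → Prop
  | .eq r q, s => s.reg r = s.reg q
  | .lt r q, s => s.reg r < s.reg q

/-- Programs. -/
inductive Prog where
  | instr (c : Instr)
  | seq (P Q : Prog)
  | ite (b : Test) (P Q : Prog)
  | loop (b : Test) (P : Prog)

/-- `Exec P s t s'`: started in `s`, the program `P` halts in the state `s'` after exactly `t` steps.
Each instruction and each evaluation of a test is one step; `loop b P` is "while `b` do `P`". -/
inductive Exec : Prog → State → ℕ → State → Prop where
  | instr (c : Instr) (s : State) : Exec (.instr c) s 1 (c.apply s)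
  | seq {P Q : Prog} {s s' s'' : State} {t t' : ℕ} :
      Exec P s t s' → Exec Q s' t' s'' → Exec (.seq P Q) s (t + t') s''
  | ite_true {b : Test} {P Q : Prog} {s s' : State} {t : ℕ} :
      b.Holds s → Exec P s t s' → Exec (.ite b P Q) s (t + 1) s'
  | ite_false {b : Test} {P Q : Prog} {s s' : State} {t : ℕ} :
      ¬ b.Holds s → Exec Q s t s' → Exec (.ite b P Q) s (t + 1) s'
  | loop_true {b : Test} {P : Prog} {s s' s'' : State} {t t' : ℕ} :
      b.Holds s → Exec P s t s' → Exec (.loop b P) s' t' s'' →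
      Exec (.loop b P) s (t + t' + 1) s''
  | loop_false {b : Test} {P : Prog} {s : State} :
      ¬ b.Holds s → Exec (.loop b P) s 1 s

end RAM

/-- `L` lists every edge of `G` exactly once, in any order and each with any orientation. -/
def IsEdgeList {n : ℕ} (G : SimpleGraph (Fin n)) (L : List (Fin n × Fin n)) : Prop :=
  (L.map fun p => s(p.1, p.2)).Nodup ∧ ∀ u v, G.Adj u v ↔ s(u, v) ∈ L.map fun p => s(p.1, p.2)

def Side.code : Side → ℕ
  | .A => 0
  | .B => 1

/-- Encoding of a bipartite graph on the vertices `0, …, n - 1` with edge list `L`, together with a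
number `k`. Registers `0, 1, 2` hold the number of vertices, the number of edges and `k`. Array `0`
holds the sides of the vertices, arrays `1` and `2` the first and second endpoints of the listed
edges. Everything else is `0`. -/
def inputState {n : ℕ} (G : BipGraph (Fin n)) (L : List (Fin n × Fin n)) (k : ℕ) : RAM.State where
  reg r := if r = 0 then n else if r = 1 then L.length else if r = 2 then k else 0
  arr a i :=
    if a = 0 then (if h : i < n then (G.side ⟨i, h⟩).code else 0)
    else if a = 1 then (if h : i < L.length then (L[i].1 : ℕ) else 0)
    else if a = 2 then (if h : i < L.length then (L[i].2 : ℕ) else 0)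
    else 0

/-- `P` decides the problem `Q` on trees within `time n` steps, `n` being the number of vertices:
it leaves the answer (`1` for yes, `0` for no) in register `0`. -/
def DecidesOnTrees (P : RAM.Prog) (Q : ∀ {n : ℕ}, BipGraph (Fin n) → ℕ → Prop)
    (time : ℕ → ℕ) : Prop :=
  ∀ (n : ℕ) (T : BipGraph (Fin n)) (L : List (Fin n × Fin n)) (k : ℕ),
    T.graph.IsTree → IsEdgeList T.graph L →
      ∃ (t : ℕ) (s : RAM.State), RAM.Exec P (inputState T L k) t s ∧ t ≤ time n ∧
        (Q T k → s.reg 0 = 1) ∧ (¬ Q T k → s.reg 0 = 0)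

/-- `P` computes on trees, within `time n` steps and in register `0`, the minimum `k` for which
`(T, k)` is a yes-instance of `Q`. (The input has no `k`; its register is initially `0`.) -/
def ComputesMinOnTrees (P : RAM.Prog) (Q : ∀ {n : ℕ}, BipGraph (Fin n) → ℕ → Prop)
    (time : ℕ → ℕ) : Prop :=
  ∀ (n : ℕ) (T : BipGraph (Fin n)) (L : List (Fin n × Fin n)),
    T.graph.IsTree → IsEdgeList T.graph L →
      ∃ (t : ℕ) (s : RAM.State), RAM.Exec P (inputState T L 0) t s ∧ t ≤ time n ∧
        IsLeast {k | Q T k} (s.reg 0)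

/-!
On a tree both problems have the same minimum `γ - 1`, where `γ` is the domination number, which for
a tree is also the largest size of a 2-packing, a set of vertices with pairwise disjoint closed
neighborhoods.

Upper bound: a dominating set `D` spans a forest of `#D` stars; deleting all other edges, `#D - 1`
of them, turns the tree into this forest.

Lower bound: mapping every copy to its original vertex turns the bicliques produced by an edit
sequence into bicliques on the original vertices that may overlap. Each operation pays for one
additional copy, one edge outside these bicliques or one missing edge inside them. A biclique with
nonempty sides `A`, `B` contains at most `#A + #B - 1` edges of the tree, and at most `1 + μ`
vertices of a 2-packing `P` if it has `μ` missing edges at them: two packing vertices on the same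
side have no common neighbor, and two on opposite sides are not adjacent. Summing over the bicliques
gives `#P - 1` operations.

Processing the vertices of a rooted tree from the leaves to the root, and putting every vertex not
yet dominated into `P` and its parent into `D`, produces a 2-packing and a dominating set of the
same size. The root is its own parent. Finding a search order by rescanning the list of edges after
each new vertex takes quadratic time.
-/

/-! ### Projecting an edit sequence to the original vertices -/

namespace BipGraph

open scoped symmDiff

variable {V W : Type}

/-- The edges of `G` as ordered pairs, each oriented from side `A` to side `B`. -/
def arcs (G : BipGraph V) : Set (V × V) :=
  {q | G.side q.1 = .A ∧ G.graph.Adj q.1 q.2}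

theorem side_snd_ne_of_mem_arcs {G : BipGraph V} {q : V × V} (hq : q ∈ G.arcs) :
    G.side q.2 ≠ .A :=
  fun h => G.side_ne _ _ hq.2 (hq.1.trans h.symm)

theorem encard_arcs (G : BipGraph V) : G.arcs.encard = G.graph.edgeSet.encard := by
  have hinj : Set.InjOn (fun q : V × V => s(q.1, q.2)) G.arcs := by
    rintro ⟨a, b⟩ hab ⟨c, d⟩ hcd h
    rcases Sym2.eq_iff.1 h with ⟨rfl, rfl⟩ | ⟨rfl, rfl⟩
    · rfl
    · exact absurd hab.1 (side_snd_ne_of_mem_arcs hcd)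
  rw [← hinj.encard_image]
  congr 1
  ext e
  induction e using Sym2.ind with | _ u v
  refine ⟨fun ⟨q, hq, he⟩ => he ▸ hq.2, fun huv => ?_⟩
  have hne : G.side u ≠ G.side v := G.side_ne u v huv
  cases hu : G.side u
  · exact ⟨(u, v), ⟨hu, huv⟩, rfl⟩
  · have hv : G.side v = .A := by
      cases hv : G.side v
      · rfl
      · exact absurd (hu.trans hv.symm) hne
    exact ⟨(v, u), ⟨hv, huv.symm⟩, Sym2.eq_swap⟩

theorem encard_symmDiff_arcs_le_one {G G' : BipGraph V} {a b : V} (hside : G'.side = G.side)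
    (hadj : ∀ u v, s(u, v) ≠ s(a, b) → (G.graph.Adj u v ↔ G'.graph.Adj u v)) :
    (G.arcs ∆ G'.arcs).encard ≤ 1 := by
  have hmem : ∀ q ∈ G.arcs ∆ G'.arcs,
      s(q.1, q.2) = s(a, b) ∧ G.side q.1 = .A ∧ G.side q.2 ≠ .A := by
    rintro q (⟨hq, hq'⟩ | ⟨hq, hq'⟩)
    · exact ⟨by_contra fun h => hq' ⟨hside ▸ hq.1, (hadj _ _ h).1 hq.2⟩, hq.1,
        side_snd_ne_of_mem_arcs hq⟩
    · exact ⟨by_contra fun h => hq' ⟨hside ▸ hq.1, (hadj _ _ h).2 hq.2⟩, hside ▸ hq.1,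
        hside ▸ side_snd_ne_of_mem_arcs hq⟩
  rw [Set.encard_le_one_iff]
  intro q r hq hr
  obtain ⟨hqe, hq1, -⟩ := hmem q hq
  obtain ⟨hre, -, hr2⟩ := hmem r hr
  rcases Sym2.eq_iff.1 (hqe.trans hre.symm) with ⟨h1, h2⟩ | ⟨h, -⟩
  · exact Prod.ext h1 h2
  · exact absurd (h ▸ hq1) hr2

theorem IsEdgeAddition.encard_symmDiff_arcs_le {G G' : BipGraph V} (h : IsEdgeAddition G G') :
    (G.arcs ∆ G'.arcs).encard ≤ 1 := by
  obtain ⟨hside, a, b, -, -, hadj⟩ := h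
  exact encard_symmDiff_arcs_le_one (a := a) (b := b) hside fun u v huv => by
    simp only [hadj, huv, or_false]

theorem IsEdgeDeletion.encard_symmDiff_arcs_le {G G' : BipGraph V} (h : IsEdgeDeletion G G') :
    (G.arcs ∆ G'.arcs).encard ≤ 1 := by
  obtain ⟨hside, a, b, -, hadj⟩ := h
  exact encard_symmDiff_arcs_le_one (a := a) (b := b) hside fun u v huv => by
    simp only [hadj, huv, ne_eq, not_false_eq_true, and_true]

/-- Merging the two copies `some v` and `none` of the split vertex `v` again. -/
def merge (v : V) (x : Option V) : V :=
  x.getD v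

theorem merge_surjective (v : V) : (merge v).Surjective :=
  fun u => ⟨some u, rfl⟩

theorem IsSplitAt.side_eq {G : BipGraph V} {v : V} {H : BipGraph (Option V)} (h : G.IsSplitAt v H) :
    ∀ x, H.side x = G.side (merge v x)
  | none => h.2.1
  | some u => h.1 u

theorem IsSplitAt.adj_iff {G : BipGraph V} {v : V} {H : BipGraph (Option V)}
    (h : G.IsSplitAt v H) {u w : V} :
    G.graph.Adj u w ↔ ∃ x y, merge v x = u ∧ merge v y = w ∧ H.graph.Adj x y := by
  have hside := h.side_eq
  obtain ⟨-, -, hother, hcopy⟩ := h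
  by_cases hu : u = v <;> by_cases hw : w = v
  · subst hu hw
    refine iff_of_false (G.graph.loopless.irrefl _) ?_
    rintro ⟨x, y, hx, hy, hxy⟩
    exact H.side_ne x y hxy (by rw [hside, hside, hx, hy])
  all_goals simp only [Option.exists, merge, Option.getD_none, Option.getD_some]
  · grind
  · grind [SimpleGraph.adj_comm]
  · grind

theorem IsSplitAt.arcs_eq {G : BipGraph V} {v : V} {H : BipGraph (Option V)}
    (h : G.IsSplitAt v H) : G.arcs = Prod.map (merge v) (merge v) '' H.arcs := by
  ext ⟨u, w⟩
  constructor
  · rintro ⟨hu, huw⟩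
    obtain ⟨x, y, rfl, rfl, hxy⟩ := h.adj_iff.1 huw
    exact ⟨(x, y), ⟨(h.side_eq x).trans hu, hxy⟩, rfl⟩
  · rintro ⟨⟨x, y⟩, ⟨hx, hxy⟩, hq⟩
    obtain ⟨rfl, rfl⟩ := Prod.ext_iff.1 hq
    exact ⟨(h.side_eq x).symm.trans hx, h.adj_iff.2 ⟨x, y, rfl, rfl, hxy⟩⟩

theorem image_symmDiff_image_subset {α β : Type*} (f : α → β) (s t : Set α) :
    (f '' s) ∆ (f '' t) ⊆ f '' (s ∆ t) := by
  rintro _ (⟨⟨x, hx, rfl⟩, hy⟩ | ⟨⟨x, hx, rfl⟩, hy⟩)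
  · exact ⟨x, .inl ⟨hx, fun h => hy ⟨x, h, rfl⟩⟩, rfl⟩
  · exact ⟨x, .inr ⟨hx, fun h => hy ⟨x, h, rfl⟩⟩, rfl⟩

/-- `φ` maps every vertex of `H` to the vertex of `G` of which it is a copy, and at most `m`
operations are accounted for by the additional copies and by the edges in which `G` differs from
the image of `H`. -/
structure IsProjection (G : BipGraph V) (H : BipGraph W) (φ : W → V) (m : ℕ) : Prop where
  surjective : φ.Surjective
  side_eq : ∀ w, H.side w = G.side (φ w)
  card_add_le :
    ENat.card W + (G.arcs ∆ (Prod.map φ φ '' H.arcs)).encard ≤ ENat.card V + m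

theorem IsProjection.of_encard_symmDiff_le_one {G G' : BipGraph V} {H : BipGraph W} {φ : W → V}
    {m : ℕ} (h : G'.IsProjection H φ m) (hside : G'.side = G.side)
    (hone : (G.arcs ∆ G'.arcs).encard ≤ 1) : G.IsProjection H φ (m + 1) where
  surjective := h.surjective
  side_eq := hside ▸ h.side_eq
  card_add_le := by
    set X := Prod.map φ φ '' H.arcs
    have htri : (G.arcs ∆ X).encard ≤ 1 + (G'.arcs ∆ X).encard :=
      (Set.encard_le_encard (symmDiff_triangle _ G'.arcs _)).trans <|
        (Set.encard_union_le _ _).trans (by gcongr)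
    calc ENat.card W + (G.arcs ∆ X).encard
        ≤ ENat.card W + (1 + (G'.arcs ∆ X).encard) := by gcongr
      _ = ENat.card W + (G'.arcs ∆ X).encard + 1 := by ring
      _ ≤ ENat.card V + m + 1 := add_le_add h.card_add_le le_rfl
      _ = ENat.card V + (m + 1 : ℕ) := by push_cast; ring

theorem IsProjection.of_isSplitAt {G : BipGraph V} {v : V} {G' : BipGraph (Option V)}
    {H : BipGraph W} {φ : W → Option V} {m : ℕ} (h : G'.IsProjection H φ m)
    (hsplit : G.IsSplitAt v G') : G.IsProjection H (merge v ∘ φ) (m + 1) where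
  surjective := (merge_surjective v).comp h.surjective
  side_eq w := (h.side_eq w).trans (hsplit.side_eq _)
  card_add_le := by
    have hV : ENat.card (Option V) = ENat.card V + 1 := by
      rw [ENat.card_congr (Equiv.optionEquivSumPUnit.{0} V), ENat.card_sum]
      simp
    rw [hsplit.arcs_eq, ← Prod.map_comp_map, Set.image_comp]
    set X := Prod.map φ φ '' H.arcs
    calc _ ≤ ENat.card W + (G'.arcs ∆ X).encard := by
          gcongr
          exact (Set.encard_le_encard (image_symmDiff_image_subset _ _ _)).trans
            (Set.encard_image_le _ _)
      _ ≤ ENat.card V + 1 + m := hV ▸ h.card_add_le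
      _ = ENat.card V + (m + 1 : ℕ) := by push_cast; ring

theorem EditSeq.exists_isProjection {S : Set Side} {G : BipGraph V} {H : BipGraph W} {m : ℕ}
    (h : EditSeq S G H m) : ∃ φ, G.IsProjection H φ m := by
  induction h with
  | nil G => exact ⟨id, Function.surjective_id, fun _ => rfl, by simp⟩
  | add hop _ ih =>
    obtain ⟨φ, hφ⟩ := ih
    exact ⟨φ, hφ.of_encard_symmDiff_le_one hop.1 hop.encard_symmDiff_arcs_le⟩
  | del hop _ ih =>
    obtain ⟨φ, hφ⟩ := ih
    exact ⟨φ, hφ.of_encard_symmDiff_le_one hop.1 hop.encard_symmDiff_arcs_le⟩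
  | split v _ hop _ ih =>
    obtain ⟨φ, hφ⟩ := ih
    exact ⟨merge v ∘ φ, hφ.of_isSplitAt hop⟩

end BipGraph

/-! ### Two-packings and bicliques -/

section Forest

open Finset

variable {V : Type*} {G : SimpleGraph V}

theorem card_edgeSet_lt_of_isAcyclic [Finite V] [Nonempty V] (hG : G.IsAcyclic) :
    Nat.card G.edgeSet < Nat.card V := by
  obtain ⟨T, hGT, -, hT⟩ :=
    SimpleGraph.connected_top.exists_isTree_le_of_le_of_isAcyclic (le_top : G ≤ ⊤) hG
  have hcard := (SimpleGraph.isTree_iff_connected_and_card.1 hT).2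
  have hle := Nat.card_mono T.edgeSet.toFinite (SimpleGraph.edgeSet_mono hGT)
  lia

theorem card_interedges_lt_of_isAcyclic [DecidableEq V] [DecidableRel G.Adj] (hG : G.IsAcyclic)
    {A B : Finset V} (hAB : Disjoint A B) (hne : (A ∪ B).Nonempty) :
    #(G.interedges A B) < #A + #B := by
  let H := G.induce (A ∪ B : Finset V)
  have : Nonempty ((A ∪ B : Finset V) : Set V) := hne.coe_sort
  have hinj : Set.InjOn (fun q : V × V => s(q.1, q.2)) (G.interedges A B) := by
    rintro ⟨a, b⟩ hab ⟨c, d⟩ hcd h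
    simp only [mem_coe, G.mem_interedges_iff] at hab hcd
    rcases Sym2.eq_iff.1 h with ⟨rfl, rfl⟩ | ⟨rfl, rfl⟩
    · rfl
    · exact absurd hab.1 (disjoint_right.1 hAB hcd.2.1)
  have himage : (fun q : V × V => s(q.1, q.2)) '' G.interedges A B ⊆
      Sym2.map Subtype.val '' H.edgeSet := by
    rintro _ ⟨⟨a, b⟩, hab, rfl⟩
    obtain ⟨ha, hb, hadj⟩ := G.mem_interedges_iff.1 (mem_coe.1 hab)
    exact ⟨s(⟨a, mem_union_left B ha⟩, ⟨b, mem_union_right A hb⟩), hadj, rfl⟩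
  calc #(G.interedges A B)
      = ((fun q : V × V => s(q.1, q.2)) '' G.interedges A B).ncard := by
        rw [hinj.ncard_image, Set.ncard_coe_finset]
    _ ≤ (Sym2.map Subtype.val '' H.edgeSet).ncard := Set.ncard_le_ncard himage
    _ ≤ H.edgeSet.ncard := Set.ncard_image_le
    _ < #(A ∪ B) := Nat.card_eq_finsetCard (A ∪ B) ▸ card_edgeSet_lt_of_isAcyclic (hG.induce _)
    _ = #A + #B := card_union_of_disjoint hAB

end Forest

section Packing

open Finset

variable {V : Type*} {G : SimpleGraph V}

/-- The closed neighborhood `N[v]`. -/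
def closedNeighborSet (G : SimpleGraph V) (v : V) : Set V :=
  insert v (G.neighborSet v)

theorem self_mem_closedNeighborSet (v : V) : v ∈ closedNeighborSet G v :=
  .inl rfl

/-- A dominating set: every vertex is in `D` or has a neighbor in `D`. -/
def IsDominating (G : SimpleGraph V) (D : Set V) : Prop :=
  ∀ v, ∃ d ∈ D, v ∈ closedNeighborSet G d

/-- A 2-packing: a set of vertices at pairwise distance greater than `2`, encoded by the
disjointness of the closed neighborhoods. -/
def IsTwoPacking (G : SimpleGraph V) (P : Set V) : Prop :=
  P.PairwiseDisjoint (closedNeighborSet G)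

theorem IsTwoPacking.eq_of_mem {P : Set V} (hP : IsTwoPacking G P) {u v w : V} (hu : u ∈ P)
    (hv : v ∈ P) (huw : w ∈ closedNeighborSet G u) (hvw : w ∈ closedNeighborSet G v) : u = v :=
  hP.elim_set hu hv w huw hvw

theorem IsTwoPacking.not_adj {P : Set V} (hP : IsTwoPacking G P) {u v : V} (hu : u ∈ P)
    (hv : v ∈ P) : ¬ G.Adj u v := fun h =>
  h.ne (hP.eq_of_mem hu hv (.inr h) (self_mem_closedNeighborSet v))

variable [DecidableEq V] [DecidableRel G.Adj]

/-- The pairs in `A ×ˢ B` that have an entry in `P` and are not edges of `G`. -/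
def missingAt (G : SimpleGraph V) [DecidableRel G.Adj] (P A B : Finset V) : Finset (V × V) :=
  {q ∈ A ×ˢ B | ¬ G.Adj q.1 q.2 ∧ (q.1 ∈ P ∨ q.2 ∈ P)}

theorem card_missingAt_comm (P A B : Finset V) :
    #(missingAt G P A B) = #(missingAt G P B A) := by
  refine card_bij' (fun q _ => q.swap) (fun q _ => q.swap) ?_ ?_ ?_ ?_ <;>
    simp +contextual [missingAt, SimpleGraph.adj_comm, or_comm]

theorem IsTwoPacking.card_inter_le {P A B : Finset V} (hP : IsTwoPacking G (P : Set V))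
    (hB : B.Nonempty) : #(P ∩ A) ≤ 1 + #(missingAt G P A B) := by
  obtain ⟨b, hb⟩ := hB
  have hadj : #{x ∈ P ∩ A | G.Adj x b} ≤ 1 := by
    refine card_le_one.2 fun x hx y hy => ?_
    simp only [mem_filter, mem_inter] at hx hy
    exact hP.eq_of_mem hx.1.1 hy.1.1 (.inr hx.2) (.inr hy.2)
  have hmissing : #{x ∈ P ∩ A | ¬ G.Adj x b} ≤ #(missingAt G P A B) := by
    refine card_le_card_of_injOn (fun x => (x, b)) (fun x hx => ?_)
      (fun x _ y _ h => congrArg Prod.fst h)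
    simp_all [missingAt]
  rw [← card_filter_add_card_filter_not (s := P ∩ A) (G.Adj · b)]
  lia

theorem IsTwoPacking.card_inter_add_card_inter_le {P A B : Finset V}
    (hP : IsTwoPacking G (P : Set V)) (hA : A.Nonempty) (hB : B.Nonempty) :
    #(P ∩ A) + #(P ∩ B) ≤ 1 + #(missingAt G P A B) := by
  rcases (P ∩ A).eq_empty_or_nonempty with hPA | hPA
  · rw [hPA, card_empty, zero_add, card_missingAt_comm]
    exact hP.card_inter_le hA
  rcases (P ∩ B).eq_empty_or_nonempty with hPB | hPB
  · rw [hPB, card_empty, add_zero]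
    exact hP.card_inter_le hB
  have hsub : (P ∩ A) ×ˢ (P ∩ B) ⊆ missingAt G P A B := fun q hq => by
    simp only [mem_product, mem_inter] at hq
    exact mem_filter.2 ⟨mem_product.2 ⟨hq.1.2, hq.2.2⟩, hP.not_adj hq.1.1 hq.2.1, .inl hq.1.1⟩
  have hcard := card_product (P ∩ A) (P ∩ B) ▸ card_le_card hsub
  have hPA' := hPA.card_pos
  have hPB' := hPB.card_pos
  nlinarith

theorem IsTwoPacking.card_inter_union_add_card_interedges_le {P A B : Finset V}
    (hP : IsTwoPacking G (P : Set V)) (hG : G.IsAcyclic) (hAB : Disjoint A B) :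
    #(P ∩ (A ∪ B)) + #(G.interedges A B) ≤ #A + #B + #(missingAt G P A B) := by
  have hunion : #(P ∩ (A ∪ B)) ≤ #(P ∩ A) + #(P ∩ B) := by
    rw [inter_union_distrib_left]
    exact card_union_le _ _
  have hPA : #(P ∩ A) ≤ #A := card_le_card inter_subset_right
  have hPB : #(P ∩ B) ≤ #B := card_le_card inter_subset_right
  have hmul := G.card_interedges_le_mul A B
  rcases A.eq_empty_or_nonempty with rfl | hA
  · simp only [card_empty, zero_mul] at hmul
    lia
  rcases B.eq_empty_or_nonempty with rfl | hB
  · simp only [card_empty, mul_zero] at hmul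
    lia
  have hedges := card_interedges_lt_of_isAcyclic hG hAB (hA.mono subset_union_left)
  have hmissing := hP.card_inter_add_card_inter_le hA hB
  lia

/-- Each biclique is charged only with the missing edges at packing vertices that lie in none of the
previous bicliques, so that no missing edge is charged twice. -/
theorem IsTwoPacking.card_inter_biUnion_add_card_filter_le {ι : Type*} {P : Finset V}
    (hP : IsTwoPacking G (P : Set V)) (hG : G.IsAcyclic) {A B : ι → Finset V}
    (hAB : ∀ i, Disjoint (A i) (B i)) (s : Finset ι) :
    #(P ∩ s.biUnion fun i => A i ∪ B i) + #{q ∈ s.biUnion fun i => A i ×ˢ B i | G.Adj q.1 q.2} ≤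
      ∑ i ∈ s, (#(A i) + #(B i)) + #{q ∈ s.biUnion fun i => A i ×ˢ B i | ¬ G.Adj q.1 q.2} := by
  classical
  induction s using Finset.induction_on with
  | empty => simp
  | insert i s hi ih =>
    set X := s.biUnion fun i => A i ∪ B i
    set U := s.biUnion fun i => A i ×ˢ B i
    have hmem : ∀ q ∈ U, q.1 ∈ X ∧ q.2 ∈ X := fun q hq => by
      obtain ⟨j, hj, hq⟩ := mem_biUnion.1 hq
      rw [mem_product] at hq
      exact ⟨mem_biUnion.2 ⟨j, hj, mem_union_left _ hq.1⟩,
        mem_biUnion.2 ⟨j, hj, mem_union_right _ hq.2⟩⟩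
    have hstep := IsTwoPacking.card_inter_union_add_card_interedges_le (P := P \ X)
      (hP.subset (by simp)) hG (hAB i)
    have hpack : #(P ∩ (A i ∪ B i ∪ X)) ≤ #((P \ X) ∩ (A i ∪ B i)) + #(P ∩ X) := by
      refine (card_le_card fun x hx => ?_).trans (card_union_le _ _)
      simp only [mem_inter, mem_union, mem_sdiff] at hx ⊢
      tauto
    have hadj : #{q ∈ A i ×ˢ B i ∪ U | G.Adj q.1 q.2} ≤
        #(G.interedges (A i) (B i)) + #{q ∈ U | G.Adj q.1 q.2} := by
      rw [filter_union]
      exact card_union_le _ _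
    have hmissing : #(missingAt G (P \ X) (A i) (B i)) + #{q ∈ U | ¬ G.Adj q.1 q.2} ≤
        #{q ∈ A i ×ˢ B i ∪ U | ¬ G.Adj q.1 q.2} := by
      rw [← card_union_of_disjoint]
      · refine card_le_card fun q hq => ?_
        simp only [missingAt, mem_union, mem_filter, mem_product] at hq ⊢
        tauto
      · refine disjoint_left.2 fun q hq hqU => ?_
        have hqX := hmem q (mem_filter.1 hqU).1
        simp only [missingAt, mem_filter, mem_sdiff] at hq
        tauto
    rw [biUnion_insert, biUnion_insert, sum_insert hi]
    lia

end Packing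

namespace BipGraph

open Finset
open scoped symmDiff

variable {V W : Type}

theorem IsBiclusterGraph.mem_arcs_iff {H : BipGraph W} (hH : H.IsBiclusterGraph) {q : W × W} :
    q ∈ H.arcs ↔ H.graph.connectedComponentMk q.1 = H.graph.connectedComponentMk q.2 ∧
      H.side q.1 = .A ∧ H.side q.2 ≠ .A := by
  refine ⟨fun hq => ⟨SimpleGraph.ConnectedComponent.eq.2 hq.2.reachable, hq.1,
    side_snd_ne_of_mem_arcs hq⟩, fun ⟨hc, hA, hB⟩ => ⟨hA, hH _ _ ?_ ?_⟩⟩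
  · exact SimpleGraph.ConnectedComponent.eq.1 hc
  · exact fun h => hB (h.symm.trans hA)

theorem IsBiclusterGraph.exists_bicliques [Finite W] {H : BipGraph W} (hH : H.IsBiclusterGraph) :
    ∃ (ι : Type) (_ : Fintype ι) (A B : ι → Finset W),
      (∀ q, q ∈ H.arcs ↔ ∃ i, q.1 ∈ A i ∧ q.2 ∈ B i) ∧
      (∀ i, ∀ w ∈ A i, H.side w = .A) ∧ (∀ i, ∀ w ∈ B i, H.side w ≠ .A) ∧
      (∀ w, ∃ i, w ∈ A i ∨ w ∈ B i) ∧ ∑ i, (#(A i) + #(B i)) = Nat.card W := by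
  classical
  have := Fintype.ofFinite W
  let comp := H.graph.connectedComponentMk
  refine ⟨H.graph.ConnectedComponent, inferInstance, fun c => {w | comp w = c ∧ H.side w = .A},
    fun c => {w | comp w = c ∧ H.side w ≠ .A}, fun q => ?_, fun c w hw => (mem_filter.1 hw).2.2,
    fun c w hw => (mem_filter.1 hw).2.2, fun w => ?_, ?_⟩
  · simp only [hH.mem_arcs_iff, mem_filter, mem_univ, true_and, comp]
    exact ⟨fun ⟨hc, hA, hB⟩ => ⟨_, ⟨rfl, hA⟩, hc.symm, hB⟩,
      fun ⟨_, ⟨hc, hA⟩, hc', hB⟩ => ⟨hc.trans hc'.symm, hA, hB⟩⟩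
  · by_cases hw : H.side w = .A
    · exact ⟨comp w, .inl (by simp [hw])⟩
    · exact ⟨comp w, .inr (by simp [hw])⟩
  · rw [Nat.card_eq_fintype_card, ← card_univ,
      card_eq_sum_card_fiberwise (f := comp) (t := univ) fun _ _ => mem_coe.2 (mem_univ _)]
    refine sum_congr rfl fun c _ => ?_
    rw [← card_filter_add_card_filter_not (s := {w | comp w = c}) (H.side · = .A), filter_filter,
      filter_filter]

theorem IsProjection.card_add_ncard_inter_le [Finite W] {G : BipGraph V} {H : BipGraph W}
    {φ : W → V} {m : ℕ} (hφ : G.IsProjection H φ m) (hH : H.IsBiclusterGraph)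
    (hG : G.graph.IsAcyclic) {P : Finset V} (hP : IsTwoPacking G.graph (P : Set V)) :
    #P + (G.arcs ∩ Prod.map φ φ '' H.arcs).ncard ≤
      Nat.card W + (Prod.map φ φ '' H.arcs \ G.arcs).ncard := by
  classical
  obtain ⟨ι, _, A, B, harcs, hA, hB, hcover, hcard⟩ := hH.exists_bicliques
  let U : Finset (V × V) := univ.biUnion fun i => (A i).image φ ×ˢ (B i).image φ
  have hside {i v} (hv : v ∈ (A i).image φ) : G.side v = .A := by
    obtain ⟨w, hw, rfl⟩ := mem_image.1 hv
    exact hφ.side_eq w ▸ hA i w hw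
  have hdisj (i) : Disjoint ((A i).image φ) ((B i).image φ) := by
    refine disjoint_left.2 fun v hvA hvB => ?_
    obtain ⟨w, hw, rfl⟩ := mem_image.1 hvB
    exact hB i w hw ((hφ.side_eq w).trans (hside hvA))
  have hU : (U : Set (V × V)) = Prod.map φ φ '' H.arcs := by
    ext ⟨u, v⟩
    simp only [U, coe_biUnion, Set.mem_iUnion, mem_coe, mem_univ, mem_product, mem_image,
      Set.mem_image, harcs, Prod.exists, Prod.map_apply, Prod.mk.injEq]
    grind
  have hmem {q} (hq : q ∈ U) : q ∈ G.arcs ↔ G.graph.Adj q.1 q.2 := by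
    obtain ⟨i, -, hq⟩ := mem_biUnion.1 hq
    exact and_iff_right (hside (mem_product.1 hq).1)
  have hedges : #{q ∈ U | G.graph.Adj q.1 q.2} = (G.arcs ∩ U).ncard := by
    rw [← filter_congr fun q => hmem, Set.inter_comm, ← Set.ncard_coe_finset, coe_filter]
    rfl
  have hmissing : #{q ∈ U | ¬ G.graph.Adj q.1 q.2} = (U \ G.arcs : Set _).ncard := by
    rw [← filter_congr fun q hq => not_congr (hmem hq), ← Set.ncard_coe_finset, coe_filter]
    rfl
  have hpart : P ∩ univ.biUnion (fun i => (A i).image φ ∪ (B i).image φ) = P := by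
    refine inter_eq_left.2 fun v _ => ?_
    obtain ⟨w, rfl⟩ := hφ.surjective v
    obtain ⟨i, hi⟩ := hcover w
    exact mem_biUnion.2 ⟨i, mem_univ i, by grind⟩
  have hcharge := hP.card_inter_biUnion_add_card_filter_le hG hdisj univ
  rw [hpart, hedges, hmissing, hU] at hcharge
  refine hcharge.trans (Nat.add_le_add_right (hcard ▸ sum_le_sum fun i _ => ?_) _)
  exact add_le_add card_image_le card_image_le

theorem CanBecomeBicluster.card_add_ncard_edgeSet_le [Finite V] {S : Set Side} {G : BipGraph V}
    {m : ℕ} (h : G.CanBecomeBicluster S m) (hG : G.graph.IsAcyclic) {P : Finset V}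
    (hP : IsTwoPacking G.graph (P : Set V)) :
    #P + G.graph.edgeSet.ncard ≤ Nat.card V + m := by
  obtain ⟨W, H, hseq, hH⟩ := h
  obtain ⟨φ, hφ⟩ := hseq.exists_isProjection
  have hbound := hφ.card_add_le
  have : Finite W := by
    rw [← ENat.card_lt_top]
    refine (le_self_add.trans hbound).trans_lt ?_
    rw [ENat.card_eq_coe_natCard]
    exact_mod_cast ENat.natCast_lt_top _
  have hpacking := hφ.card_add_ncard_inter_le hH hG hP
  set X := Prod.map φ φ '' H.arcs
  have hchange : Nat.card W + ((G.arcs \ X).ncard + (X \ G.arcs).ncard) ≤ Nat.card V + m := by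
    rw [← Set.ncard_union_eq disjoint_sdiff_sdiff]
    rw [ENat.card_eq_coe_natCard, ENat.card_eq_coe_natCard,
      ← Set.Finite.cast_ncard_eq (Set.toFinite _)] at hbound
    exact_mod_cast hbound
  have hedges : (G.arcs ∩ X).ncard + (G.arcs \ X).ncard = G.graph.edgeSet.ncard := by
    rw [Set.ncard_inter_add_ncard_sdiff_eq_ncard, Set.ncard_def, encard_arcs, Set.ncard_def]
  lia

end BipGraph

/-! ### Star forests -/

section MapGraph

open Finset

variable {V : Type*}

/-- The graph of a map `f`, joining `v` to `f v`: a star forest with centers `f v` if `f` is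
idempotent, and a tree if `f` is the parent function of one. -/
def mapGraph (f : V → V) : SimpleGraph V :=
  SimpleGraph.fromRel (f · = ·)

theorem apply_eq_of_reachable_mapGraph {f : V → V} (hf : ∀ v, f (f v) = f v) {u v : V}
    (huv : (mapGraph f).Reachable u v) : f u = f v := by
  obtain ⟨walk⟩ := huv
  induction walk with
  | nil => rfl
  | cons h _ ih =>
    rw [← ih]
    obtain ⟨-, rfl | rfl⟩ := h
    · rw [hf]
    · rw [hf]

theorem card_filter_ne_le_ncard_edgeSet_mapGraph [Fintype V] [DecidableEq V] {f : V → V}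
    (hf : ∀ v, f (f v) = f v) : #{v | f v ≠ v} ≤ (mapGraph f).edgeSet.ncard := by
  rw [← Set.ncard_coe_finset]
  refine Set.ncard_le_ncard_of_injOn (fun v => s(v, f v)) ?_ ?_
  · intro v hv
    exact ⟨(mem_filter.1 hv).2.symm, .inl rfl⟩
  · intro v hv w _ h
    have hv := (mem_filter.1 hv).2
    grind

end MapGraph

namespace BipGraph

open Finset

variable {V : Type}

/-- `G` without the edges in `s`, on the same two sides. -/
def deleteEdges (G : BipGraph V) (s : Set (Sym2 V)) : BipGraph V where
  graph := G.graph.deleteEdges s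
  side := G.side
  side_ne u v h := G.side_ne u v (G.graph.deleteEdges_le s h)

theorem deleteEdges_deleteEdges (G : BipGraph V) (s t : Set (Sym2 V)) :
    (G.deleteEdges s).deleteEdges t = G.deleteEdges (s ∪ t) := by
  simp only [deleteEdges, SimpleGraph.deleteEdges_deleteEdges]

theorem isEdgeDeletion_deleteEdges_singleton {G : BipGraph V} {e : Sym2 V}
    (he : e ∈ G.graph.edgeSet) : IsEdgeDeletion G (G.deleteEdges {e}) := by
  induction e using Sym2.ind with | _ a b
  exact ⟨rfl, a, b, he, fun _ _ => SimpleGraph.deleteEdges_adj⟩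

theorem EditSeq.deleteEdges (S : Set Side) {G : BipGraph V} {F : Finset (Sym2 V)}
    (hF : (F : Set (Sym2 V)) ⊆ G.graph.edgeSet) : EditSeq S G (G.deleteEdges F) #F := by
  classical
  induction F using Finset.induction_on generalizing G with
  | empty =>
    have hG : G.deleteEdges ∅ = G := by
      simp only [BipGraph.deleteEdges, SimpleGraph.deleteEdges_empty]
    rw [coe_empty, hG]
    exact .nil G
  | insert e F heF ih =>
    rw [coe_insert, Set.insert_subset_iff] at hF
    have hF' : (F : Set (Sym2 V)) ⊆ (G.deleteEdges {e}).graph.edgeSet := by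
      rw [BipGraph.deleteEdges, SimpleGraph.edgeSet_deleteEdges]
      exact Set.subset_sdiff_singleton hF.2 heF
    rw [card_insert_of_notMem heF, coe_insert, Set.insert_eq, ← deleteEdges_deleteEdges]
    exact .del (isEdgeDeletion_deleteEdges_singleton hF.1) (ih hF')

theorem isBiclusterGraph_of_graph_eq_mapGraph {H : BipGraph V} {f : V → V}
    (hf : ∀ v, f (f v) = f v) (hH : H.graph = mapGraph f) : H.IsBiclusterGraph := by
  intro u v hreach hside
  have hcenter : f u = f v := apply_eq_of_reachable_mapGraph hf (hH ▸ hreach)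
  have hadj (w : V) (hw : w ≠ f w) : H.side w ≠ H.side (f w) :=
    H.side_ne _ _ (hH ▸ ⟨hw, .inl rfl⟩)
  rw [hH, mapGraph, SimpleGraph.fromRel_adj]
  refine ⟨fun h => hside (h ▸ rfl), ?_⟩
  by_contra! hne
  have hu := hadj u (by grind)
  have hv := hadj v (by grind)
  rw [hcenter] at hu
  cases hu' : H.side u <;> cases hv' : H.side v <;> cases hw : H.side (f v) <;>
    simp_all only [ne_eq, not_true_eq_false, reduceCtorEq]

theorem exists_canBecomeBicluster_of_isDominating [Fintype V] (S : Set Side) {G : BipGraph V}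
    {D : Finset V} (hD : IsDominating G.graph (D : Set V)) :
    ∃ m, G.CanBecomeBicluster S m ∧ m + Fintype.card V ≤ G.graph.edgeSet.ncard + #D := by
  classical
  have hcenter (v : V) : ∃ d ∈ D, (v ∈ D → d = v) ∧ (d = v ∨ G.graph.Adj d v) := by
    by_cases hv : v ∈ D
    · exact ⟨v, hv, fun _ => rfl, .inl rfl⟩
    · obtain ⟨d, hd, hvd⟩ := hD v
      exact ⟨d, hd, fun h => absurd h hv, hvd.imp_left Eq.symm⟩
  choose f hfD hfix hadj using hcenter
  have hf (v : V) : f (f v) = f v := hfix (f v) (hfD v)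
  have hle : mapGraph f ≤ G.graph := by
    rintro u v ⟨hne, rfl | rfl⟩
    · exact ((hadj u).resolve_left hne.symm).symm
    · exact (hadj v).resolve_left hne
  obtain ⟨F, hF⟩ := (Set.toFinite (G.graph.edgeSet \ (mapGraph f).edgeSet)).exists_finset_coe
  have hFG : (F : Set (Sym2 V)) ⊆ G.graph.edgeSet := hF ▸ Set.sdiff_subset
  have hstars : (G.deleteEdges F).graph = mapGraph f := by
    rw [hF]
    exact SimpleGraph.deleteEdges_sdiff_eq_of_le hle
  refine ⟨#F, ⟨V, _, EditSeq.deleteEdges S hFG,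
    isBiclusterGraph_of_graph_eq_mapGraph hf hstars⟩, ?_⟩
  have hmoved := card_filter_ne_le_ncard_edgeSet_mapGraph hf
  have hfixed : #{v | ¬ f v ≠ v} ≤ #D :=
    card_le_card fun v hv => not_not.1 (mem_filter.1 hv).2 ▸ hfD v
  have hdeleted := Set.ncard_sdiff_add_ncard_of_subset (SimpleGraph.edgeSet_subset_edgeSet.2 hle)
  rw [← hF, Set.ncard_coe_finset] at hdeleted
  have htotal := card_filter_add_card_filter_not (s := univ) (fun v => f v ≠ v)
  rw [card_univ] at htotal
  lia

theorem exists_canBecomeBicluster_iff_of_isTree [Finite V] (S : Set Side) {T : BipGraph V}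
    (hT : T.graph.IsTree) {P D : Finset V} (hP : IsTwoPacking T.graph (P : Set V))
    (hD : IsDominating T.graph (D : Set V)) (hDP : #D ≤ #P) (k : ℕ) :
    (∃ m ≤ k, T.CanBecomeBicluster S m) ↔ #P - 1 ≤ k := by
  have := Fintype.ofFinite V
  have hedges : T.graph.edgeSet.ncard + 1 = Fintype.card V := by
    classical
    rw [← hT.card_edgeFinset, ← SimpleGraph.coe_edgeFinset, Set.ncard_coe_finset]
  constructor
  · rintro ⟨m, hmk, hm⟩
    have := hm.card_add_ncard_edgeSet_le hT.isAcyclic hP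
    rw [Nat.card_eq_fintype_card] at this
    lia
  · intro hk
    obtain ⟨m, hm, hcard⟩ := exists_canBecomeBicluster_of_isDominating S hD
    exact ⟨m, by lia, hm⟩

end BipGraph

/-! ### Search orders and the greedy packing -/

section GreedyPacking

variable {V : Type*} {G : SimpleGraph V} {p : V → V} {l : List V}

/-- The vertices of the list, newest first, have been found one after the other by a search of `G`
that started at a root and discovered every other vertex `y` from its parent `p y`. The root is its
own parent. -/
inductive SearchOrder (G : SimpleGraph V) (p : V → V) : List V → Prop
  | nil : SearchOrder G p []
  | root {r : V} (hr : p r = r) : SearchOrder G p [r]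
  | attach {l : List V} {y : V} (hl : SearchOrder G p l) (hy : y ∉ l) (hmem : p y ∈ l)
      (hadj : G.Adj y (p y)) : SearchOrder G p (y :: l)

namespace SearchOrder

theorem nodup (h : SearchOrder G p l) : l.Nodup := by
  induction h with
  | nil => exact List.nodup_nil
  | root => exact List.nodup_singleton _
  | attach _ hy _ _ ih => exact List.nodup_cons.2 ⟨hy, ih⟩

theorem tail {y : V} (h : SearchOrder G p (y :: l)) : SearchOrder G p l := by
  cases h with
  | root => exact .nil
  | attach hl => exact hl

theorem parent_mem (h : SearchOrder G p l) : ∀ x ∈ l, p x ∈ l := by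
  induction h with grind

theorem parent_eq_or_adj (h : SearchOrder G p l) : ∀ x ∈ l, p x = x ∨ G.Adj x (p x) := by
  induction h with grind

theorem congr {q : V → V} (h : SearchOrder G p l) (hpq : ∀ x ∈ l, p x = q x) :
    SearchOrder G q l := by
  induction h with
  | nil => exact .nil
  | root hr => exact .root (by grind)
  | attach _ hy hmem hadj ih =>
    rw [hpq _ List.mem_cons_self] at hmem hadj
    exact .attach (ih fun x hx => hpq x (List.mem_cons_of_mem _ hx)) hy hmem hadj

theorem cons_update [DecidableEq V] {x y : V} (h : SearchOrder G p l) (hx : x ∈ l) (hy : y ∉ l)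
    (hyx : G.Adj y x) : SearchOrder G (Function.update p y x) (y :: l) := by
  refine .attach (h.congr fun z hz => ?_) hy ?_ ?_
  · rw [Function.update_of_ne (ne_of_mem_of_not_mem hz hy)]
  · rwa [Function.update_self]
  · rwa [Function.update_self]

theorem reachable_mapGraph (h : SearchOrder G p l) :
    ∀ x ∈ l, ∀ y ∈ l, (mapGraph p).Reachable x y := by
  induction h with
  | nil => grind
  | root => grind [SimpleGraph.Reachable.refl]
  | @attach l y _ hy hmem hadj ih =>
    have hparent : (mapGraph p).Reachable y (p y) :=
      SimpleGraph.Adj.reachable ⟨hadj.ne, .inl rfl⟩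
    have hroot (x : V) (hx : x ∈ y :: l) : (mapGraph p).Reachable x (p y) := by
      rcases List.mem_cons.1 hx with rfl | hx
      · exact hparent
      · exact ih x hx (p y) hmem
    exact fun x hx z hz => (hroot x hx).trans (hroot z hz).symm

theorem mapGraph_eq_of_isTree (h : SearchOrder G p l) (hG : G.IsTree) (hl : ∀ v, v ∈ l) :
    mapGraph p = G := by
  have : Nonempty V := hG.connected.nonempty
  have hle : mapGraph p ≤ G := by
    rintro u v ⟨hne, rfl | rfl⟩
    · exact (h.parent_eq_or_adj u (hl u)).resolve_left hne.symm
    · exact ((h.parent_eq_or_adj v (hl v)).resolve_left hne).symm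
  have hconn : (mapGraph p).Connected :=
    ⟨fun u v => h.reachable_mapGraph u (hl u) v (hl v)⟩
  exact hle.antisymm ((SimpleGraph.isTree_iff_minimal_connected.1 hG).2 hconn hle)

end SearchOrder

theorem mem_of_connected_of_closed {s : Set V} (hG : G.Connected) (hs : s.Nonempty)
    (hclosed : ∀ u v, G.Adj u v → u ∈ s → v ∈ s) (v : V) : v ∈ s := by
  obtain ⟨r, hr⟩ := hs
  obtain ⟨walk⟩ := hG.preconnected r v
  by_contra hv
  obtain ⟨d, -, hd, hd'⟩ := walk.exists_boundary_dart s hr hv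
  exact hd' (hclosed _ _ d.adj hd)

/-- State of the greedy algorithm on a tree with parent function `p` when the vertices in `l` have
still to be processed, in this order: the members of the packing `P` have been processed, and their
parents dominate all processed vertices. -/
structure GreedyState (p : V → V) (l : List V) (P : Set V) : Prop where
  notMem : ∀ i ∈ P, i ∉ l
  isTwoPacking : IsTwoPacking (mapGraph p) P
  dominated : ∀ v, v ∉ l → ∃ i ∈ P, p i = p v ∨ p i = v ∨ p (p i) = v

namespace GreedyState

variable {P : Set V} {v : V}

theorem empty (hl : ∀ v, v ∈ l) : GreedyState p l ∅ :=
  ⟨fun _ h => h.elim, Set.pairwiseDisjoint_empty, fun v hv => absurd (hl v) hv⟩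

theorem skip (h : GreedyState p (v :: l) P)
    (hv : ∃ i ∈ P, p i = p v ∨ p i = v ∨ p (p i) = v) : GreedyState p l P where
  notMem i hi hil := h.notMem i hi (List.mem_cons_of_mem v hil)
  isTwoPacking := h.isTwoPacking
  dominated u hu := by
    by_cases huv : u = v
    · exact huv ▸ hv
    · exact h.dominated u (List.not_mem_cons_of_ne_of_not_mem huv hu)

theorem take (h : GreedyState p (v :: l) P) (hl : SearchOrder G p (v :: l))
    (hv : ¬ ∃ i ∈ P, p i = p v ∨ p i = v ∨ p (p i) = v) :
    GreedyState p l (insert v P) where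
  notMem := by
    have := h.notMem
    have := hl.nodup
    grind
  isTwoPacking := by
    have hparent := hl.parent_mem
    have hnbr {x w : V} (hw : w ∈ closedNeighborSet (mapGraph p) x) : w = x ∨ p x = w ∨ p w = x :=
      hw.imp_right And.right
    refine h.isTwoPacking.insert fun i hi _ => Set.disjoint_left.2 fun w hwv hwi => ?_
    have hil := h.notMem i hi
    grind
  dominated u hu := by
    by_cases huv : u = v
    · exact ⟨v, .inl rfl, .inl (huv ▸ rfl)⟩
    · obtain ⟨i, hi, hiu⟩ := h.dominated u (List.not_mem_cons_of_ne_of_not_mem huv hu)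
      exact ⟨i, .inr hi, hiu⟩

theorem isDominating_image (h : GreedyState p [] P) :
    IsDominating (mapGraph p) (p '' P) := by
  have hadj (x y : V) (hxy : p x = y ∨ p y = x) : x ∈ closedNeighborSet (mapGraph p) y := by
    by_cases hne : x = y
    · exact .inl hne
    · exact .inr ⟨Ne.symm hne, hxy.symm⟩
  intro v
  obtain ⟨i, hi, hiv⟩ := h.dominated v List.not_mem_nil
  refine ⟨p i, Set.mem_image_of_mem p hi, ?_⟩
  rcases hiv with h | h | h
  · exact hadj _ _ (.inl h.symm)
  · exact .inl h.symm
  · exact hadj _ _ (.inr h)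

end GreedyState

end GreedyPacking

/-! ### Programs -/

namespace RAM

/-- Total correctness with a time bound: started in `s`, the program `P` halts within `t` steps in
a state satisfying `Q`. -/
def Prog.HaltsWithin (P : Prog) (s : State) (t : ℕ) (Q : State → Prop) : Prop :=
  ∃ t' ≤ t, ∃ s', Exec P s t' s' ∧ Q s'

/-- Consecutive execution of a list of instructions. The empty list becomes a move of register `0`
to itself, there being no empty program. -/
def Prog.block : List Instr → Prog
  | [] => .instr (.move 0 0)
  | c :: cs => .seq (.instr c) (block cs)

namespace Prog.HaltsWithin

variable {P P' : Prog} {s : State} {t t' : ℕ} {Q Q' : State → Prop} {b : Test}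

theorem mono (h : P.HaltsWithin s t Q) (ht : t ≤ t') (hQ : ∀ s', Q s' → Q' s') :
    P.HaltsWithin s t' Q' := by
  obtain ⟨u, hu, s', hexec, hs'⟩ := h
  exact ⟨u, hu.trans ht, s', hexec, hQ s' hs'⟩

theorem seq (h : P.HaltsWithin s t Q) (h' : ∀ s', Q s' → P'.HaltsWithin s' t' Q') :
    (Prog.seq P P').HaltsWithin s (t + t') Q' := by
  obtain ⟨u, hu, s', hexec, hs'⟩ := h
  obtain ⟨u', hu', s'', hexec', hs''⟩ := h' s' hs'
  exact ⟨u + u', by lia, s'', .seq hexec hexec', hs''⟩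

theorem block {cs : List Instr} (h : Q (cs.foldl (fun s c => c.apply s) s)) :
    (Prog.block cs).HaltsWithin s (cs.length + 1) Q := by
  induction cs generalizing s with
  | nil =>
    refine ⟨1, le_rfl, _, .instr _ s, ?_⟩
    rwa [Instr.apply, State.setReg, Function.update_eq_self]
  | cons c cs ih =>
    have hc : (Prog.instr c).HaltsWithin s 1 (· = c.apply s) :=
      ⟨1, le_rfl, _, .instr c s, rfl⟩
    have hseq := hc.seq (P' := Prog.block cs) fun _ (hs' : _ = _) => by
      rw [hs']
      exact ih h
    exact hseq.mono (Nat.add_comm ..).le fun _ => id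

theorem ite (h : b.Holds s → P.HaltsWithin s t Q) (h' : ¬ b.Holds s → P'.HaltsWithin s t Q) :
    (Prog.ite b P P').HaltsWithin s (t + 1) Q := by
  by_cases hb : b.Holds s
  · obtain ⟨u, hu, s', hexec, hs'⟩ := h hb
    exact ⟨u + 1, by lia, s', .ite_true hb hexec, hs'⟩
  · obtain ⟨u, hu, s', hexec, hs'⟩ := h' hb
    exact ⟨u + 1, by lia, s', .ite_false hb hexec, hs'⟩

theorem loop {I : State → Prop} (μ : State → ℕ)
    (hbody : ∀ s, I s → b.Holds s → P.HaltsWithin s t fun s' => I s' ∧ μ s' < μ s) (hs : I s) :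
    (Prog.loop b P).HaltsWithin s ((t + 1) * μ s + 1) fun s' => I s' ∧ ¬ b.Holds s' := by
  induction hμ : μ s using Nat.strong_induction_on generalizing s with | _ m ih
  subst hμ
  by_cases hb : b.Holds s
  · obtain ⟨u, hu, s', hexec, hs', hlt⟩ := hbody s hs hb
    obtain ⟨u', hu', s'', hexec', hs''⟩ := ih (μ s') hlt hs' rfl
    have := Nat.mul_le_mul_left (t + 1) (Nat.succ_le_of_lt hlt)
    exact ⟨u + u' + 1, by lia, s'', .loop_true hb hexec hexec', hs''⟩
  · exact ⟨1, by lia, s, .loop_false hb, hs, hb⟩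

end Prog.HaltsWithin

/-- `a` holds the entries of the list, the last entry at index `0`. -/
def Stored {n : ℕ} (a : ℕ → ℕ) : List (Fin n) → Prop
  | [] => True
  | y :: l => a l.length = y ∧ Stored a l

theorem Stored.update {n i x : ℕ} {a : ℕ → ℕ} {l : List (Fin n)} (h : Stored a l)
    (hi : l.length ≤ i) : Stored (Function.update a i x) l := by
  induction l with
  | nil => trivial
  | cons y l ih =>
    rw [List.length_cons] at hi
    refine ⟨?_, ih h.2 (by lia)⟩
    rw [Function.update_of_ne (by lia)]
    exact h.1

end RAM

namespace IsEdgeList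

variable {n : ℕ} {G : SimpleGraph (Fin n)} {L : List (Fin n × Fin n)}

theorem adj_getElem (hL : IsEdgeList G L) {i : ℕ} (hi : i < L.length) : G.Adj L[i].1 L[i].2 :=
  (hL.2 _ _).2 (List.mem_map.2 ⟨L[i], List.getElem_mem hi, rfl⟩)

theorem exists_getElem (hL : IsEdgeList G L) {u v : Fin n} (h : G.Adj u v) :
    ∃ (i : ℕ) (hi : i < L.length), s(L[i].1, L[i].2) = s(u, v) := by
  obtain ⟨q, hq, huv⟩ := List.mem_map.1 ((hL.2 u v).1 h)
  obtain ⟨i, hi, rfl⟩ := List.getElem_of_mem hq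
  exact ⟨i, hi, huv⟩

theorem length_add_one (hL : IsEdgeList G L) (hG : G.IsTree) : L.length + 1 = n := by
  classical
  have hedges : G.edgeFinset = (L.map fun q => s(q.1, q.2)).toFinset := by
    ext e
    induction e using Sym2.ind with | _ u v
    rw [List.mem_toFinset, ← hL.2 u v, SimpleGraph.mem_edgeFinset, SimpleGraph.mem_edgeSet]
  have hcard := hG.card_edgeFinset
  rwa [hedges, List.toFinset_card_of_nodup hL.1, List.length_map, Fintype.card_fin] at hcard

end IsEdgeList

theorem forall_mem_iff_card_le_length {V : Type*} [Fintype V] {l : List V} (hl : l.Nodup) :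
    (∀ v, v ∈ l) ↔ Fintype.card V ≤ l.length := by
  classical
  rw [← List.toFinset_card_of_nodup hl]
  simp only [← List.mem_toFinset, ← Finset.eq_univ_iff_forall, ← Finset.card_eq_iff_eq_univ]
  exact ⟨Eq.ge, (Finset.card_le_univ _).antisymm⟩

namespace RAM

/-! The registers `0`, `2` and the arrays `1`, `2` below are those of the input. Register `zero` is
never written, so it holds `0`, which is also the root of the search. -/

namespace Reg

@[simp] abbrev vertexCount : ℕ := 0
@[simp] abbrev budget : ℕ := 2
@[simp] abbrev orderLength : ℕ := 3
@[simp] abbrev edge : ℕ := 4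
@[simp] abbrev vertex : ℕ := 5
@[simp] abbrev parent : ℕ := 6
@[simp] abbrev vertexMark : ℕ := 7
@[simp] abbrev parentMark : ℕ := 8
@[simp] abbrev one : ℕ := 9
@[simp] abbrev zero : ℕ := 10
@[simp] abbrev grandparent : ℕ := 11
@[simp] abbrev count : ℕ := 12

end Reg

namespace Arr

@[simp] abbrev edgeFst : ℕ := 1
@[simp] abbrev edgeSnd : ℕ := 2
@[simp] abbrev visited : ℕ := 3
@[simp] abbrev order : ℕ := 4
@[simp] abbrev parent : ℕ := 5
@[simp] abbrev covered : ℕ := 6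
@[simp] abbrev selected : ℕ := 7

end Arr

/-- Appends the vertex in register `y` to the search order, with the vertex in register `x` as its
parent, and returns to the first edge. -/
def attachProg (y x : ℕ) : Prog :=
  .block [.const Reg.one 1, .store Arr.visited y Reg.one, .store Arr.order Reg.orderLength y,
    .store Arr.parent y x, .succ Reg.orderLength, .const Reg.edge 0]

/-- Loads the endpoints of the current edge and their marks. -/
def loadEdgeProg : Prog :=
  .block [.load Reg.vertex Arr.edgeFst Reg.edge, .load Reg.parent Arr.edgeSnd Reg.edge,
    .load Reg.vertexMark Arr.visited Reg.vertex, .load Reg.parentMark Arr.visited Reg.parent]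

/-- Looks at one edge: if exactly one endpoint has been visited, then the other one is attached to
it, else the next edge is up. -/
def scanProg : Prog :=
  .seq loadEdgeProg <|
  .ite (.eq Reg.vertexMark Reg.parentMark) (.block [.succ Reg.edge]) <|
  .ite (.lt Reg.vertexMark Reg.parentMark) (attachProg Reg.vertex Reg.parent)
    (attachProg Reg.parent Reg.vertex)

/-- Starts the search order with the root `0`. -/
def initProg : Prog :=
  .block [.const Reg.one 1, .store Arr.visited Reg.zero Reg.one, .const Reg.orderLength 1]

/-- Computes a search order of a tree from the root `0`. -/
def searchProg : Prog :=
  .seq initProg <|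
  .loop (.lt Reg.orderLength Reg.vertexCount) scanProg

theorem update_val_apply {n : ℕ} (a : ℕ → ℕ) (y : Fin n) (x : ℕ) (v : Fin n) :
    Function.update a y x v = if v = y then x else a v := by
  simp only [Function.update_apply, Fin.val_inj]

variable {n k : ℕ} {T : BipGraph (Fin n)} {L : List (Fin n × Fin n)} {l : List (Fin n)}
  {p : Fin n → Fin n} {s : State}

/-- The invariant of the search, with `l` the current search order, `p` the parent function, and
the edges before the current one known not to leave `l`. -/
structure Searching (T : BipGraph (Fin n)) (L : List (Fin n × Fin n)) (k : ℕ) (l : List (Fin n))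
    (p : Fin n → Fin n) (s : State) : Prop where
  reg_eq : ∀ r ∈ [Reg.vertexCount, Reg.budget, Reg.zero, Reg.count],
    s.reg r = (inputState T L k).reg r
  arr_eq : ∀ a ∈ [Arr.edgeFst, Arr.edgeSnd, Arr.covered, Arr.selected],
    s.arr a = (inputState T L k).arr a
  orderLength : s.reg Reg.orderLength = l.length
  edge_le : s.reg Reg.edge ≤ L.length
  visited : ∀ v : Fin n, s.arr Arr.visited v = if v ∈ l then 1 else 0
  order : Stored (s.arr Arr.order) l
  parent : ∀ v : Fin n, s.arr Arr.parent v = p v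
  ne_nil : l ≠ []
  searchOrder : SearchOrder T.graph p l
  closed : ∀ i (h : i < L.length), i < s.reg Reg.edge → (L[i].1 ∈ l ↔ L[i].2 ∈ l)

/-- The number of edges that the search may still look at. -/
def searchVariant (m : ℕ) (s : State) : ℕ :=
  (s.reg Reg.vertexCount - s.reg Reg.orderLength) * (m + 1) + (m - s.reg Reg.edge)

namespace Searching

theorem setReg (h : Searching T L k l p s) {r x : ℕ}
    (hr : r ∈ [Reg.vertex, Reg.parent, Reg.vertexMark, Reg.parentMark]) :
    Searching T L k l p (s.setReg r x) := by
  have hframe (q : ℕ) (hq : q ∉ [Reg.vertex, Reg.parent, Reg.vertexMark, Reg.parentMark]) :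
      (s.setReg r x).reg q = s.reg q :=
    Function.update_of_ne (ne_of_mem_of_not_mem hr hq).symm ..
  exact
    { h with
      reg_eq q hq := (hframe q (by grind)).trans (h.reg_eq q hq)
      orderLength := (hframe _ (by simp)).trans h.orderLength
      edge_le := (hframe Reg.edge (by simp)).trans_le h.edge_le
      closed := hframe Reg.edge (by simp) ▸ h.closed }

theorem load (h : Searching T L k l p s) (he : s.reg Reg.edge < L.length) :
    loadEdgeProg.HaltsWithin s 5 fun s' =>
      Searching T L k l p s' ∧
      (∀ r ∈ [Reg.vertexCount, Reg.orderLength, Reg.edge], s'.reg r = s.reg r) ∧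
      s'.reg Reg.vertex = L[s.reg Reg.edge].1 ∧ s'.reg Reg.parent = L[s.reg Reg.edge].2 ∧
      s'.reg Reg.vertexMark = (if L[s.reg Reg.edge].1 ∈ l then 1 else 0) ∧
      s'.reg Reg.parentMark = if L[s.reg Reg.edge].2 ∈ l then 1 else 0 := by
  have hfst : s.arr Arr.edgeFst (s.reg Reg.edge) = L[s.reg Reg.edge].1 := by
    simp [h.arr_eq, inputState, he]
  have hsnd : s.arr Arr.edgeSnd (s.reg Reg.edge) = L[s.reg Reg.edge].2 := by
    simp [h.arr_eq, inputState, he]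
  refine .block ⟨?_, ?_, ?_⟩
  · exact (((h.setReg (by simp)).setReg (by simp)).setReg (by simp)).setReg (by simp)
  · simp [Instr.apply, State.setReg]
  · simp [Instr.apply, State.setReg, hfst, hsnd, h.visited]

theorem next (h : Searching T L k l p s) (he : s.reg Reg.edge < L.length)
    (hl : L[s.reg Reg.edge].1 ∈ l ↔ L[s.reg Reg.edge].2 ∈ l) :
    (Prog.block [.succ Reg.edge]).HaltsWithin s 2 fun s' =>
      (∃ l p, Searching T L k l p s') ∧ searchVariant L.length s' < searchVariant L.length s := by
  refine .block ⟨⟨l, p, { h with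
    reg_eq := ?_
    orderLength := ?_
    edge_le := ?_
    closed := ?_ }⟩, ?_⟩
  · have := h.reg_eq
    simpa [Instr.apply, State.setReg] using this
  · simp [Instr.apply, State.setReg, h.orderLength]
  · simpa [Instr.apply, State.setReg] using he
  · simp only [List.foldl, Instr.apply, State.setReg, Function.update_self]
    intro i hi hlt
    rcases Nat.lt_succ_iff_lt_or_eq.1 hlt with hlt | rfl
    · exact h.closed i hi hlt
    · exact hl
  · have hedge : L.length - (s.reg Reg.edge + 1) < L.length - s.reg Reg.edge := by lia
    simpa [searchVariant, Instr.apply, State.setReg] using hedge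

theorem attach (h : Searching T L k l p s) {y x : ℕ} {v w : Fin n}
    (hy : s.reg y = v) (hx : s.reg x = w) (hy1 : y ≠ Reg.one) (hx1 : x ≠ Reg.one)
    (hv : v ∉ l) (hw : w ∈ l) (hvw : T.graph.Adj v w)
    (hlt : s.reg Reg.orderLength < s.reg Reg.vertexCount) :
    (attachProg y x).HaltsWithin s 7 fun s' =>
      (∃ l p, Searching T L k l p s') ∧ searchVariant L.length s' < searchVariant L.length s := by
  refine .block ⟨⟨v :: l, Function.update p v w, ?_⟩, ?_⟩
  · simp only [List.foldl, Instr.apply, State.setReg, State.setArr]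
    constructor
    case reg_eq => simpa using h.reg_eq
    case arr_eq => simpa using h.arr_eq
    case orderLength => simp [h.orderLength]
    case edge_le => simp
    case visited =>
      intro u
      simp [hy, hy1, update_val_apply, h.visited, ite_or]
    case order =>
      simpa [hy, hy1, h.orderLength, Stored] using h.order.update le_rfl
    case parent =>
      intro u
      simp [hy, hx, hx1, hy1, h.parent, Function.update_apply, Fin.val_inj, apply_ite Fin.val]
    case ne_nil => exact List.cons_ne_nil _ _
    case searchOrder => exact h.searchOrder.cons_update hw hv hvw
    case closed => simp
  · have hcount : s.reg Reg.vertexCount - s.reg Reg.orderLength =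
        s.reg Reg.vertexCount - (s.reg Reg.orderLength + 1) + 1 := by lia
    suffices (s.reg Reg.vertexCount - (s.reg Reg.orderLength + 1)) * (L.length + 1) + L.length <
        searchVariant L.length s by
      simpa [searchVariant, State.setReg, State.setArr, Instr.apply] using this
    rw [searchVariant, hcount, Nat.add_mul]
    lia

theorem edge_lt (h : Searching T L k l p s) (hT : T.graph.Connected) (hL : IsEdgeList T.graph L)
    (hlt : s.reg Reg.orderLength < s.reg Reg.vertexCount) : s.reg Reg.edge < L.length := by
  by_contra! hge
  have hclosed (u v : Fin n) (huv : T.graph.Adj u v) (hu : u ∈ l) : v ∈ l := by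
    obtain ⟨i, hi, he⟩ := hL.exists_getElem huv
    have := h.closed i hi (hi.trans_le hge)
    grind
  have hall := mem_of_connected_of_closed hT (List.exists_mem_of_ne_nil l h.ne_nil) hclosed
  have hcard := (forall_mem_iff_card_le_length h.searchOrder.nodup).1 hall
  rw [Fintype.card_fin] at hcard
  rw [h.orderLength, h.reg_eq _ (by simp)] at hlt
  exact hlt.not_ge hcard

theorem scan (h : Searching T L k l p s) (hT : T.graph.Connected) (hL : IsEdgeList T.graph L)
    (hlt : s.reg Reg.orderLength < s.reg Reg.vertexCount) :
    scanProg.HaltsWithin s 14 fun s' =>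
      (∃ l p, Searching T L k l p s') ∧ searchVariant L.length s' < searchVariant L.length s := by
  have he := h.edge_lt hT hL hlt
  have hadj := hL.adj_getElem he
  refine Prog.HaltsWithin.seq (t' := 9) (h.load he)
    fun s₁ ⟨h₁, hframe, hfst, hsnd, hmark₁, hmark₂⟩ => ?_
  have hvariant : searchVariant L.length s₁ = searchVariant L.length s := by
    simp only [searchVariant, hframe _, List.mem_cons, true_or, or_true]
  rw [← hframe Reg.orderLength (by simp), ← hframe Reg.vertexCount (by simp)] at hlt
  simp only [← hframe Reg.edge (by simp)] at he hadj hfst hsnd hmark₁ hmark₂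
  rw [← hvariant]
  refine .ite (fun hboth => ?_) fun hone => .ite (fun hsecond => ?_) fun hfirst => ?_
  · simp only [Test.Holds, hmark₁, hmark₂] at hboth
    exact (h₁.next he (by grind)).mono (by norm_num) fun _ => id
  · simp only [Test.Holds, hmark₁, hmark₂] at hsecond
    exact h₁.attach hfst hsnd (by simp) (by simp) (by grind) (by grind) hadj hlt
  · simp only [Test.Holds, hmark₁, hmark₂] at hone hfirst
    exact h₁.attach hsnd hfst (by simp) (by simp) (by grind) (by grind) hadj.symm hlt

theorem init (T : BipGraph (Fin n)) (L : List (Fin n × Fin n)) (k : ℕ) (hn : 0 < n) :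
    initProg.HaltsWithin (inputState T L k) 4
      (Searching T L k [⟨0, hn⟩] fun _ => ⟨0, hn⟩) := by
  refine .block ?_
  simp only [List.foldl, Instr.apply, State.setReg, State.setArr]
  constructor
  case reg_eq => simp
  case arr_eq => simp
  case orderLength => simp
  case edge_le => simp [inputState]
  case visited => simp [inputState, Function.update_apply, Fin.ext_iff]
  case order => simp [inputState, Stored]
  case parent => simp [inputState]
  case ne_nil => simp
  case searchOrder => exact .root rfl
  case closed => simp [inputState]

end Searching

theorem haltsWithin_searchProg (hT : T.graph.IsTree) (hL : IsEdgeList T.graph L) (k : ℕ) :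
    searchProg.HaltsWithin (inputState T L k) (15 * n ^ 2 + 5) fun s =>
      ∃ l p, Searching T L k l p s ∧ ∀ v, v ∈ l := by
  have hn : 0 < n := hL.length_add_one hT ▸ Nat.succ_pos _
  have hm := hL.length_add_one hT
  refine Prog.HaltsWithin.mono (t := 4 + (15 * n ^ 2 + 1))
    ((Searching.init T L k hn).seq fun s hs => ?_) (by lia) fun _ => id
  have hvariant : searchVariant L.length s ≤ n ^ 2 := by
    have hcount : s.reg Reg.vertexCount = n := hs.reg_eq _ (by simp)
    have hsq : n ^ 2 = (n - 1) * n + n := by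
      rw [← Nat.succ_mul, Nat.succ_eq_add_one, Nat.sub_add_cancel hn, sq]
    rw [searchVariant, hcount, hs.orderLength, hm, List.length_singleton, hsq]
    lia
  have hloop := Prog.HaltsWithin.loop (searchVariant L.length)
    (b := .lt Reg.orderLength Reg.vertexCount) (I := fun s => ∃ l p, Searching T L k l p s)
    (fun _ ⟨_, _, h⟩ hlt => h.scan hT.connected hL hlt) ⟨_, _, hs⟩
  refine hloop.mono (by lia) fun s' ⟨⟨l, p, h⟩, hge⟩ => ⟨l, p, h, ?_⟩
  rw [Test.Holds, h.orderLength, h.reg_eq _ (by simp), not_lt] at hge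
  rw [forall_mem_iff_card_le_length h.searchOrder.nodup, Fintype.card_fin]
  exact hge
/-- Takes the last vertex off the search order and loads its parent and the marks that show whether
it is already dominated. -/
def unloadProg : Prog :=
  .block [.pred Reg.orderLength, .load Reg.vertex Arr.order Reg.orderLength,
    .load Reg.parent Arr.parent Reg.vertex, .load Reg.vertexMark Arr.covered Reg.vertex,
    .load Reg.parentMark Arr.selected Reg.parent]

/-- Adds the current vertex to the packing and its parent to the dominating set. -/
def takeProg : Prog :=
  .block [.const Reg.one 1, .store Arr.selected Reg.parent Reg.one,
    .store Arr.covered Reg.parent Reg.one, .load Reg.grandparent Arr.parent Reg.parent,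
    .store Arr.covered Reg.grandparent Reg.one, .succ Reg.count]

/-- Processes the last vertex of the search order. -/
def selectProg : Prog :=
  .seq unloadProg <|
  .ite (.eq Reg.vertexMark Reg.zero)
    (.ite (.eq Reg.parentMark Reg.zero) takeProg (.block []))
    (.block [])

/-- Leaves the size of a maximum two-packing of a tree in the register `count`. -/
def packingProg : Prog :=
  .seq searchProg <|
  .loop (.lt Reg.zero Reg.orderLength) selectProg

variable {l' : List (Fin n)} {P : Finset (Fin n)} {v : Fin n}

/-- The invariant of the greedy algorithm, with `l` the search order left on the machine, `l'` the
vertices still to be processed (`l`, or `v :: l` while `v` is being processed), `p` the parent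
function of the search and `P` the packing found so far. -/
structure Selecting (G : SimpleGraph (Fin n)) (k : ℕ) (p : Fin n → Fin n) (l l' : List (Fin n))
    (P : Finset (Fin n)) (s : State) : Prop where
  budget : s.reg Reg.budget = k
  zero : s.reg Reg.zero = 0
  orderLength : s.reg Reg.orderLength = l.length
  count : s.reg Reg.count = P.card
  order : Stored (s.arr Arr.order) l
  parent : ∀ v : Fin n, s.arr Arr.parent v = p v
  covered : ∀ v : Fin n, s.arr Arr.covered v = 0 ↔ ¬ ∃ i ∈ P, p i = v ∨ p (p i) = v
  selected : ∀ v : Fin n, s.arr Arr.selected v = 0 ↔ ¬ ∃ i ∈ P, p i = v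
  searchOrder : SearchOrder G p l'
  greedy : GreedyState p l' (P : Set (Fin n))

theorem Searching.selecting (h : Searching T L k l p s) (hl : ∀ v, v ∈ l) :
    Selecting T.graph k p l l ∅ s where
  budget := h.reg_eq Reg.budget (by simp)
  zero := h.reg_eq Reg.zero (by simp)
  orderLength := h.orderLength
  count := h.reg_eq Reg.count (by simp)
  order := h.order
  parent := h.parent
  covered := by simp [h.arr_eq, inputState]
  selected := by simp [h.arr_eq, inputState]
  searchOrder := h.searchOrder
  greedy := by simpa using GreedyState.empty hl

namespace Selecting

variable {G : SimpleGraph (Fin n)}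

theorem setReg (h : Selecting G k p l l' P s) {r x : ℕ}
    (hr : r ∈ [Reg.vertex, Reg.parent, Reg.vertexMark, Reg.parentMark]) :
    Selecting G k p l l' P (s.setReg r x) := by
  have hframe (q : ℕ) (hq : q ∉ [Reg.vertex, Reg.parent, Reg.vertexMark, Reg.parentMark]) :
      (s.setReg r x).reg q = s.reg q :=
    Function.update_of_ne (ne_of_mem_of_not_mem hr hq).symm ..
  exact
    { h with
      budget := (hframe _ (by simp)).trans h.budget
      zero := (hframe _ (by simp)).trans h.zero
      orderLength := (hframe _ (by simp)).trans h.orderLength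
      count := (hframe _ (by simp)).trans h.count }

theorem unload (h : Selecting G k p (v :: l) (v :: l) P s) :
    unloadProg.HaltsWithin s 6 fun s' =>
      Selecting G k p l (v :: l) P s' ∧ s'.reg Reg.parent = p v ∧
      (s'.reg Reg.vertexMark = 0 ↔ ¬ ∃ i ∈ P, p i = v ∨ p (p i) = v) ∧
      (s'.reg Reg.parentMark = 0 ↔ ¬ ∃ i ∈ P, p i = p v) := by
  have hlength : s.reg Reg.orderLength - 1 = l.length := by
    rw [h.orderLength, List.length_cons, Nat.add_sub_cancel]
  have hpop : Selecting G k p l (v :: l) P (s.setReg Reg.orderLength (s.reg Reg.orderLength - 1)) :=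
    { h with
      budget := by simpa [State.setReg] using h.budget
      zero := by simpa [State.setReg] using h.zero
      orderLength := by simpa [State.setReg] using hlength
      count := by simpa [State.setReg] using h.count
      order := h.order.2 }
  have hv : s.arr Arr.order l.length = v := h.order.1
  refine .block ⟨?_, ?_⟩
  · exact (((hpop.setReg (by simp)).setReg (by simp)).setReg (by simp)).setReg (by simp)
  · simp [Instr.apply, State.setReg, hlength, hv, h.parent, h.covered, h.selected]

theorem skip (h : Selecting G k p l (v :: l) P s)
    (hv : ∃ i ∈ P, p i = p v ∨ p i = v ∨ p (p i) = v) : Selecting G k p l l P s :=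
  { h with
    searchOrder := h.searchOrder.tail
    greedy := h.greedy.skip hv }

theorem take (h : Selecting G k p l (v :: l) P s) (hparent : s.reg Reg.parent = p v)
    (hv : ¬ ∃ i ∈ P, p i = p v ∨ p i = v ∨ p (p i) = v) :
    takeProg.HaltsWithin s 7 (Selecting G k p l l (insert v P)) := by
  have hvP : v ∉ P := fun hmem => h.greedy.notMem v hmem List.mem_cons_self
  refine .block ?_
  simp only [List.foldl, Instr.apply, State.setReg, State.setArr]
  constructor
  case budget => simpa using h.budget
  case zero => simpa using h.zero
  case orderLength => simpa using h.orderLength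
  case count => simpa [Finset.card_insert_of_notMem hvP] using h.count
  case order => simpa using h.order
  case parent => simpa using h.parent
  case covered =>
    intro u
    have hcovered := h.covered u
    suffices (if u = p (p v) then 1 else if u = p v then 1 else s.arr Arr.covered u) = 0 ↔
        ¬ ∃ i ∈ insert v P, p i = u ∨ p (p i) = u by
      simpa [hparent, h.parent, update_val_apply] using this
    grind
  case selected =>
    intro u
    have hselected := h.selected u
    suffices (if u = p v then 1 else s.arr Arr.selected u) = 0 ↔ ¬ ∃ i ∈ insert v P, p i = u by
      simpa [hparent, update_val_apply] using this
    grind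
  case searchOrder => exact h.searchOrder.tail
  case greedy => simpa using h.greedy.take h.searchOrder hv

theorem select (h : Selecting G k p (v :: l) (v :: l) P s) :
    selectProg.HaltsWithin s 15 fun s' => ∃ P, Selecting G k p l l P s' := by
  refine Prog.HaltsWithin.seq (t' := 9) h.unload fun s' ⟨h', hparent, hcovered, hselected⟩ => ?_
  have hskip (hv : ∃ i ∈ P, p i = p v ∨ p i = v ∨ p (p i) = v) :
      (Prog.block []).HaltsWithin s' 1 fun s'' => ∃ P, Selecting G k p l l P s'' :=
    .block ⟨P, h'.skip hv⟩
  refine .ite (fun hv => .ite (fun hpv => ?_) fun hpv => ?_) fun hv => ?_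
  all_goals rw [Test.Holds, h'.zero, hcovered] at hv
  · rw [Test.Holds, h'.zero, hselected] at hpv
    exact (h'.take hparent (by grind)).mono le_rfl fun _ h => ⟨_, h⟩
  · rw [Test.Holds, h'.zero, hselected] at hpv
    exact (hskip (by grind)).mono (by simp) fun _ => id
  · exact (hskip (by grind)).mono (by simp) fun _ => id

end Selecting

theorem haltsWithin_packingProg (hT : T.graph.IsTree) (hL : IsEdgeList T.graph L) (k : ℕ) :
    packingProg.HaltsWithin (inputState T L k) (15 * n ^ 2 + 16 * n + 6) fun s =>
      s.reg Reg.budget = k ∧ ∃ P D : Finset (Fin n), s.reg Reg.count = P.card ∧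
        IsTwoPacking T.graph P ∧ IsDominating T.graph D ∧ D.card ≤ P.card := by
  refine Prog.HaltsWithin.mono (t := 15 * n ^ 2 + 5 + (16 * n + 1))
    ((haltsWithin_searchProg hT hL k).seq fun s ⟨l, p, hs, hl⟩ => ?_) (by lia) fun _ => id
  have hG : mapGraph p = T.graph := hs.searchOrder.mapGraph_eq_of_isTree hT hl
  have hvariant : s.reg Reg.orderLength ≤ n := by
    simpa [hs.orderLength] using hs.searchOrder.nodup.length_le_card
  have hloop := Prog.HaltsWithin.loop (fun s => s.reg Reg.orderLength)
    (b := .lt Reg.zero Reg.orderLength) (P := selectProg) (t := 15)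
    (I := fun s => ∃ l P, Selecting T.graph k p l l P s) (s := s) ?_ ⟨l, ∅, hs.selecting hl⟩
  · refine hloop.mono (by lia) fun s' ⟨⟨l, P, h⟩, hend⟩ => ?_
    rw [Test.Holds, h.zero, h.orderLength, List.length_pos_iff, not_not] at hend
    subst hend
    refine ⟨h.budget, P, P.image p, h.count, hG ▸ h.greedy.isTwoPacking, ?_,
      Finset.card_image_le⟩
    rw [← hG, Finset.coe_image]
    exact h.greedy.isDominating_image
  · rintro s ⟨l, P, h⟩ hpos
    rw [Test.Holds, h.zero, h.orderLength, List.length_pos_iff_exists_cons] at hpos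
    obtain ⟨v, l, rfl⟩ := hpos
    refine h.select.mono le_rfl fun s' ⟨P, h'⟩ => ⟨⟨l, P, h'⟩, ?_⟩
    simp [h.orderLength, h'.orderLength]

/-- Computes the minimum number of operations, leaving it in the register `count`. -/
def countProg : Prog :=
  .seq packingProg (.block [.pred Reg.count])

theorem haltsWithin_countProg (hT : T.graph.IsTree) (hL : IsEdgeList T.graph L) (k : ℕ) :
    countProg.HaltsWithin (inputState T L k) (39 * n ^ 2) fun s => s.reg Reg.budget = k ∧
      ∀ S j, (∃ m ≤ j, T.CanBecomeBicluster S m) ↔ s.reg Reg.count ≤ j := by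
  have hn : 0 < n := hL.length_add_one hT ▸ Nat.succ_pos _
  refine Prog.HaltsWithin.mono (t := 15 * n ^ 2 + 16 * n + 6 + 2)
    ((haltsWithin_packingProg hT hL k).seq fun s ⟨hk, P, D, hcount, hP, hD, hDP⟩ => ?_)
    (by nlinarith) fun _ => id
  refine .block ⟨hk, fun S j => ?_⟩
  rw [BipGraph.exists_canBecomeBicluster_iff_of_isTree S hT hP hD hDP]
  simp [Instr.apply, State.setReg, hcount]

/-- Decides whether at most `k` operations suffice. -/
def decideProg : Prog :=
  .seq countProg <|
  .ite (.lt Reg.budget Reg.count) (.block [.const 0 0]) (.block [.const 0 1])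

/-- Computes the minimum number of operations, leaving it in register `0`. -/
def minProg : Prog :=
  .seq countProg (.block [.move 0 Reg.count])

theorem decidesOnTrees_decideProg (S : Set Side) :
    DecidesOnTrees decideProg (fun G k => ∃ m ≤ k, G.CanBecomeBicluster S m)
      (fun n => 42 * n ^ 2) := by
  intro n T L k hT hL
  have hn : 0 < n := hL.length_add_one hT ▸ Nat.succ_pos _
  obtain ⟨t, ht, s, hexec, hyes, hno⟩ : decideProg.HaltsWithin (inputState T L k)
      (39 * n ^ 2 + 3) fun s => ((∃ m ≤ k, T.CanBecomeBicluster S m) → s.reg 0 = 1) ∧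
        (¬ (∃ m ≤ k, T.CanBecomeBicluster S m) → s.reg 0 = 0) := by
    refine (haltsWithin_countProg hT hL k).seq fun s ⟨hk, hcount⟩ => ?_
    rw [hcount]
    refine .ite (fun hlt => .block ?_) fun hlt => .block ?_
    · rw [Test.Holds, hk] at hlt
      simpa [Instr.apply, State.setReg] using hlt
    · rw [Test.Holds, hk] at hlt
      simpa [Instr.apply, State.setReg] using hlt
  exact ⟨t, s, hexec, ht.trans (by nlinarith), hyes, hno⟩

theorem computesMinOnTrees_minProg (S : Set Side) :
    ComputesMinOnTrees minProg (fun G k => ∃ m ≤ k, G.CanBecomeBicluster S m)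
      (fun n => 42 * n ^ 2) := by
  intro n T L hT hL
  have hn : 0 < n := hL.length_add_one hT ▸ Nat.succ_pos _
  obtain ⟨t, ht, s, hexec, hleast⟩ : minProg.HaltsWithin (inputState T L 0) (39 * n ^ 2 + 2)
      fun s => IsLeast {k | ∃ m ≤ k, T.CanBecomeBicluster S m} (s.reg 0) := by
    refine (haltsWithin_countProg hT hL 0).seq fun s ⟨_, hcount⟩ => .block ?_
    simp only [hcount]
    exact isLeast_Ici
  exact ⟨t, s, hexec, ht.trans (by nlinarith), hleast⟩

end RAM

theorem mainTheorem5 :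
    (∃ (P : RAM.Prog) (C : ℕ), DecidesOnTrees P BCEVS (fun n => C * n ^ 2)) ∧
    (∃ (P : RAM.Prog) (C : ℕ), DecidesOnTrees P BCEOVS (fun n => C * n ^ 2)) ∧
    (∃ (P : RAM.Prog) (C : ℕ), ComputesMinOnTrees P BCEVS (fun n => C * n ^ 2)) ∧
    (∃ (P : RAM.Prog) (C : ℕ), ComputesMinOnTrees P BCEOVS (fun n => C * n ^ 2)) :=
  ⟨⟨_, _, RAM.decidesOnTrees_decideProg Set.univ⟩, ⟨_, _, RAM.decidesOnTrees_decideProg {Side.B}⟩,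
    ⟨_, _, RAM.computesMinOnTrees_minProg Set.univ⟩,
    ⟨_, _, RAM.computesMinOnTrees_minProg {Side.B}⟩⟩
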